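/- Let $m,n\in\mathbb N$, let $2\le p<\infty$ and $1\le k\le n$. For a complex $m\times n$ matrix $X$ let $\sigma_1(X)\ge\sigma_2(X)\ge\cdots\ge\sigma_{\min\{m,n\}}(X)$ be its singular values, put $\sigma_i(X)=0$ for $i>\min\{m,n\}$, and let $$\|X\|_{(p,k)}=\bigl(\sigma_1^p(X)+\cdots+\sigma_k^p(X)\bigr)^{1/p}$$ be the Ky Fan $p$-$k$ norm. For $A,B\in\mathbb M_{m\times n}(\mathbb C)$, say that $A$ is norm-parallel to $B$, written $A\parallel B$, if $\|A+\mu B\|_{(p,k)}=\|A\|_{(p,k)}+\|B\|_{(p,k)}$ for some $\mu\in\mathbb C$ with $|\mu|=1$. Write $\langle x,y\rangle=y^*x$ on $\mathbb C^n$, and let $(A^*A)^{(p-2)/2}$ be the power of the positive semidefinite matrix $A^*A$ given by the spectral theorem (the identity matrix if $p=2$). Then for all $A,B\in\mathbb M_{m\times n}(\mathbb C)$: $A\parallel B$ if and only if there exist $k$ orthonormal vectors $v_1,\dots,v_k\in\mathbb C^n$ satisfying $$A^*Av_i=\sigma_i^2(A)\,v_i\quad\text{for all }1\le i\le k$$ and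 a scalar $\lambda\in\mathbb C$, $|\lambda|=1$, such that $$\sum_{i=1}^{k}\bigl\langle (A^*A)^{\frac{p-2}{2}}A^*B\,v_i,v_i\bigr\rangle=\lambda\,\|A\|_{(p,k)}^{\,p-1}\,\|B\|_{(p,k)} .$$ -/

import Mathlib

open scoped Matrix

noncomputable section

namespace KyFanPK

/-- `sval A i` is the `(i+1)`-st largest singular value of the complex `m × n` matrix `A`
(counted with multiplicity, zero-based index), acting between Euclidean spaces; it is `0` for
`i ≥ min m n`. -/
def sval {m n : ℕ} (A : Matrix (Fin m) (Fin n) ℂ) (i : ℕ) : ℝ :=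
  (Matrix.toEuclideanLin A).singularValues i

/-- The Ky Fan `p`-`k` norm: the `ℓ^p` norm of the `k` largest singular values. -/
def kyFanNorm {m n : ℕ} (p : ℝ) (k : ℕ) (A : Matrix (Fin m) (Fin n) ℂ) : ℝ :=
  (∑ i ∈ Finset.range k, sval A i ^ p) ^ (1 / p)

/-- Norm parallelism of `A` and `B` with respect to the Ky Fan `p`-`k` norm. -/
def NormParallel {m n : ℕ} (p : ℝ) (k : ℕ) (A B : Matrix (Fin m) (Fin n) ℂ) : Prop :=
  ∃ c : ℂ, ‖c‖ = 1 ∧ kyFanNorm p k (A + c • B) = kyFanNorm p k A + kyFanNorm p k B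

/-- The real power `(A⋆ A) ^ s`, i.e. `U * diag (d_j ^ s) * U⋆` for a spectral decomposition
`A⋆ A = U * diag d_j * U⋆`; for `s = 0` it is the identity. -/
def gramPow {m n : ℕ} (A : Matrix (Fin m) (Fin n) ℂ) (s : ℝ) : Matrix (Fin n) (Fin n) ℂ :=
  (Matrix.isHermitian_conjTranspose_mul_self A).cfc (fun x : ℝ => x ^ s)

end KyFanPK

end

/-!
The Ky Fan norm of `T` is the maximum, over orthonormal families `v` of `k` vectors, of the norm of
`(T v₁, …, T v_k)` in the `ℓ^p`-direct sum of `k` copies of the codomain. By Jensen's inequality and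
the bathtub principle, every maximiser spans a space that also contains an orthonormal system of
right singular vectors for the `k` largest singular values of `T`.

If `T + c S` has the largest norm the triangle inequality allows, a maximiser `v` for `T + c S` is
one for `T` and for `S` as well, and strict convexity of the `ℓ^p`-sum makes `T` and `S`
proportional on the span of `v`. Evaluating the norming functional of `(T u₁, …, T u_k)` at
`(S u₁, …, S u_k)`, for a singular frame `u` of `T` in that span, gives the trace formula.
Conversely the formula says that this functional norms `T` and a unimodular multiple of `S`
simultaneously, which forces equality in the triangle inequality.
-/

noncomputable section

namespace KyFanPK

section PiLp

open Finset

theorem strictConvexOn_norm_rpow {E : Type*} [NormedAddCommGroup E] [NormedSpace ℝ E]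
    [StrictConvexSpace ℝ E] {p : ℝ} (hp : 1 < p) :
    StrictConvexOn ℝ Set.univ fun x : E => ‖x‖ ^ p := by
  have hp0 : 0 < p := by linarith
  refine ⟨convex_univ, fun x _ y _ hxy a b ha hb hab => ?_⟩
  rcases eq_or_ne ‖x‖ ‖y‖ with heq | hne
  · calc ‖a • x + b • y‖ ^ p < ‖y‖ ^ p :=
          Real.rpow_lt_rpow (norm_nonneg _) (norm_combo_lt_of_ne heq.le le_rfl hxy ha hb hab) hp0
      _ = a • ‖x‖ ^ p + b • ‖y‖ ^ p := by rw [heq, ← add_smul, hab, one_smul]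
  · calc ‖a • x + b • y‖ ^ p ≤ (a • ‖x‖ + b • ‖y‖) ^ p := by
          gcongr
          refine (norm_add_le _ _).trans_eq ?_
          rw [norm_smul_of_nonneg ha.le, norm_smul_of_nonneg hb.le, smul_eq_mul, smul_eq_mul]
      _ < a • ‖x‖ ^ p + b • ‖y‖ ^ p :=
          (strictConvexOn_rpow hp).2 (norm_nonneg x) (norm_nonneg y) hne ha hb hab

theorem piLp_norm_rpow_eq_sum {ι : Type*} [Fintype ι] {p : ℝ} (hp : 0 < p) {β : ι → Type*}
    [∀ i, NormedAddCommGroup (β i)] (x : PiLp (ENNReal.ofReal p) β) :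
    ‖x‖ ^ p = ∑ i, ‖x i‖ ^ p := by
  have hq : (ENNReal.ofReal p).toReal = p := ENNReal.toReal_ofReal hp.le
  rw [PiLp.norm_eq_sum (by rwa [hq]), hq, one_div, Real.rpow_inv_rpow _ hp.ne']
  exact sum_nonneg fun i _ => by positivity

theorem strictConvexSpace_piLp {ι : Type*} [Fintype ι] {p : ℝ}
    [Fact (1 ≤ ENNReal.ofReal p)] (hp : 1 < p) (β : ι → Type*) [∀ i, NormedAddCommGroup (β i)]
    [∀ i, NormedSpace ℝ (β i)] [∀ i, StrictConvexSpace ℝ (β i)] :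
    StrictConvexSpace ℝ (PiLp (ENNReal.ofReal p) β) := by
  have hp0 : 0 < p := by linarith
  refine .of_norm_combo_lt_one fun x y hx hy hxy =>
    ⟨1 / 2, 1 / 2, by norm_num, ?_⟩
  obtain ⟨j, hj⟩ : ∃ j, x j ≠ y j := by
    by_contra! h
    exact hxy (PiLp.ext h)
  have hconv (i) := strictConvexOn_norm_rpow (E := β i) hp
  rw [← Real.rpow_lt_rpow_iff (norm_nonneg _) zero_le_one hp0, Real.one_rpow]
  calc ‖(1 / 2 : ℝ) • x + (1 / 2 : ℝ) • y‖ ^ p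
      = ∑ i, ‖(1 / 2 : ℝ) • x i + (1 / 2 : ℝ) • y i‖ ^ p := piLp_norm_rpow_eq_sum hp0 _
    _ < ∑ i, ((1 / 2 : ℝ) • ‖x i‖ ^ p + (1 / 2 : ℝ) • ‖y i‖ ^ p) :=
        sum_lt_sum
          (fun i _ =>
            (hconv i).convexOn.2 trivial trivial (by norm_num) (by norm_num) (by norm_num))
          ⟨j, mem_univ j, (hconv j).2 trivial trivial hj (by norm_num) (by norm_num) (by norm_num)⟩
    _ = 1 := by
        rw [sum_add_distrib, ← smul_sum, ← smul_sum, ← piLp_norm_rpow_eq_sum hp0,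
          ← piLp_norm_rpow_eq_sum hp0, hx, hy]
        norm_num

end PiLp

section Bathtub

open Finset

variable {n k : ℕ} {d : ℕ → ℝ} {a : Fin n → ℝ}

theorem sum_ite_lt_mul (hkn : k ≤ n) (g : ℕ → ℝ) :
    ∑ l : Fin n, (if (l : ℕ) < k then 1 else 0) * g l = ∑ l ∈ range k, g l := by
  rw [Fin.sum_univ_eq_sum_range (fun l => (if l < k then 1 else 0) * g l) n]
  simp only [ite_mul, one_mul, zero_mul, ← sum_filter]
  congr 1
  grind

theorem sum_range_sub_sum_weight_mul (hkn : k ≤ n) (d : ℕ → ℝ) (hsum : ∑ l, a l = k) (t : ℝ) :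
    ∑ l ∈ range k, d l - ∑ l, a l * d l =
      ∑ l : Fin n, ((if (l : ℕ) < k then 1 else 0) - a l) * (d l - t) := by
  have hd := sum_ite_lt_mul hkn d
  have ht := sum_ite_lt_mul hkn fun _ => t
  simp only [sub_mul, mul_sub, sum_sub_distrib, hd, ht, ← sum_mul, hsum]
  simp

-- For `k = 0` the truncated `k - 1` does no harm: the threshold `d 0` dominates every `d l`.
theorem ite_sub_weight_mul_nonneg (hd : Antitone d) (ha0 : ∀ l, 0 ≤ a l) (ha1 : ∀ l, a l ≤ 1)
    (l : Fin n) : 0 ≤ ((if (l : ℕ) < k then 1 else 0) - a l) * (d l - d (k - 1)) := by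
  split_ifs with hl
  · exact mul_nonneg (sub_nonneg.2 (ha1 l)) (sub_nonneg.2 (hd (by omega)))
  · exact mul_nonneg_of_nonpos_of_nonpos (by linarith [ha0 l]) (sub_nonpos.2 (hd (by omega)))

theorem sum_weight_mul_le_sum_range (hkn : k ≤ n) (hd : Antitone d) (ha0 : ∀ l, 0 ≤ a l)
    (ha1 : ∀ l, a l ≤ 1) (hsum : ∑ l, a l = k) : ∑ l, a l * d l ≤ ∑ l ∈ range k, d l := by
  rw [← sub_nonneg, sum_range_sub_sum_weight_mul hkn d hsum (d (k - 1))]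
  exact sum_nonneg fun l _ => ite_sub_weight_mul_nonneg hd ha0 ha1 l

theorem weight_eq_of_sum_weight_mul_eq_sum_range (hkn : k ≤ n) (hd : Antitone d)
    (ha0 : ∀ l, 0 ≤ a l) (ha1 : ∀ l, a l ≤ 1) (hsum : ∑ l, a l = k)
    (heq : ∑ l, a l * d l = ∑ l ∈ range k, d l) (l : Fin n) (hl : d l ≠ d (k - 1)) :
    a l = if (l : ℕ) < k then 1 else 0 := by
  have hzero := sum_range_sub_sum_weight_mul hkn d hsum (d (k - 1))
  rw [heq, sub_self, eq_comm,
    sum_eq_zero_iff_of_nonneg fun l _ => ite_sub_weight_mul_nonneg hd ha0 ha1 l] at hzero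
  have hfactor := (mul_eq_zero.1 (hzero l (mem_univ l))).resolve_right (sub_ne_zero.2 hl)
  linarith

end Bathtub

section SemiInner

open Finset

variable {𝕜 F ι : Type*} [RCLike 𝕜] [NormedAddCommGroup F] [InnerProductSpace 𝕜 F] [Fintype ι]

/-- The Lumer–Giles semi-inner product of the `ℓ^p`-direct sum of copies of `F`, scaled by
`‖x‖ ^ (p - 2)` and linear in `y`: up to a positive factor, `semiInner p x` is the norming
functional of `x`. -/
def semiInner (p : ℝ) (x y : PiLp (ENNReal.ofReal p) fun _ : ι => F) : 𝕜 :=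
  ∑ i, ((‖x i‖ ^ (p - 2) : ℝ) : 𝕜) * inner 𝕜 (x i) (y i)

theorem semiInner_add_right (p : ℝ) (x y z : PiLp (ENNReal.ofReal p) fun _ : ι => F) :
    (semiInner p x (y + z) : 𝕜) = semiInner p x y + semiInner p x z := by
  simp only [semiInner, PiLp.add_apply, inner_add_right, mul_add, sum_add_distrib]

theorem semiInner_smul_right (p : ℝ) (c : 𝕜) (x y : PiLp (ENNReal.ofReal p) fun _ : ι => F) :
    semiInner p x (c • y) = c * semiInner p x y := by
  simp only [semiInner, PiLp.smul_apply, inner_smul_right, mul_sum, mul_left_comm c]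

theorem semiInner_self {p : ℝ} (hp : 0 < p) (x : PiLp (ENNReal.ofReal p) fun _ : ι => F) :
    semiInner p x x = ((‖x‖ ^ p : ℝ) : 𝕜) := by
  rw [piLp_norm_rpow_eq_sum hp, semiInner, RCLike.ofReal_sum]
  refine sum_congr rfl fun i _ => ?_
  rw [inner_self_eq_norm_sq_to_K, ← RCLike.ofReal_pow, ← RCLike.ofReal_mul, ← Real.rpow_two,
    ← Real.rpow_add' (norm_nonneg _) (by simpa using hp.ne'), sub_add_cancel]

theorem norm_semiInner_le {p : ℝ} (hp : 1 < p) (x y : PiLp (ENNReal.ofReal p) fun _ : ι => F) :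
    ‖(semiInner p x y : 𝕜)‖ ≤ ‖x‖ ^ (p - 1) * ‖y‖ := by
  have hp0 : 0 < p := by linarith
  have : Fact (1 ≤ ENNReal.ofReal p) := ⟨by simpa using hp.le⟩
  have hconj : (p / (p - 1)).HolderConjugate p :=
    (Real.HolderConjugate.conjExponent hp).symm
  have hterm : ∀ i, ‖((‖x i‖ ^ (p - 2) : ℝ) : 𝕜) * inner 𝕜 (x i) (y i)‖ ≤
      ‖x i‖ ^ (p - 1) * ‖y i‖ := fun i => by
    rw [norm_mul, RCLike.norm_of_nonneg (by positivity), show p - 1 = p - 2 + 1 by ring,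
      Real.rpow_add_one' (norm_nonneg _) (by linarith), mul_assoc]
    gcongr
    exact norm_inner_le_norm _ _
  calc ‖(semiInner p x y : 𝕜)‖ ≤ ∑ i, ‖x i‖ ^ (p - 1) * ‖y i‖ :=
        (norm_sum_le _ _).trans (sum_le_sum fun i _ => hterm i)
    _ ≤ (∑ i, (‖x i‖ ^ (p - 1)) ^ (p / (p - 1))) ^ (1 / (p / (p - 1))) *
          (∑ i, ‖y i‖ ^ p) ^ (1 / p) :=
        Real.inner_le_Lp_mul_Lq_of_nonneg _ hconj (fun i _ => by positivity)
          (fun i _ => norm_nonneg _)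
    _ = (‖x‖ ^ p) ^ (1 / (p / (p - 1))) * (‖y‖ ^ p) ^ (1 / p) := by
        simp only [piLp_norm_rpow_eq_sum hp0, ← Real.rpow_mul (norm_nonneg _),
          mul_div_cancel₀ p (sub_pos.2 hp).ne']
    _ = ‖x‖ ^ (p - 1) * ‖y‖ := by
        rw [← Real.rpow_mul (norm_nonneg x), ← Real.rpow_mul (norm_nonneg y),
          mul_one_div_cancel hp0.ne', Real.rpow_one, one_div_div, mul_div_cancel₀ _ hp0.ne']

theorem norm_smul_eq_norm_smul_of_piLp_norm_add_eq {p : ℝ} (hp : 1 < p)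
    {x y : PiLp (ENNReal.ofReal p) fun _ : ι => F} (h : ‖x + y‖ = ‖x‖ + ‖y‖) :
    (‖x‖ : 𝕜) • y = (‖y‖ : 𝕜) • x := by
  have : Fact (1 ≤ ENNReal.ofReal p) := ⟨by simpa using hp.le⟩
  let : InnerProductSpace ℝ F := InnerProductSpace.rclikeToReal 𝕜 F
  have := strictConvexSpace_piLp hp fun _ : ι => F
  exact sameRay_iff_norm_smul_eq.1 (sameRay_iff_norm_add.2 h)

end SemiInner

section Geometry

open Module
open scoped InnerProductSpace

variable {𝕜 E ι : Type*} [RCLike 𝕜] [NormedAddCommGroup E] [InnerProductSpace 𝕜 E] [Fintype ι]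

theorem norm_starProjection_span_range_sq {v : ι → E} (hv : Orthonormal 𝕜 v)
    [(Submodule.span 𝕜 (Set.range v)).HasOrthogonalProjection] (x : E) :
    ‖(Submodule.span 𝕜 (Set.range v)).starProjection x‖ ^ 2 = ∑ i, ‖⟪v i, x⟫_𝕜‖ ^ 2 := by
  let b := Basis.span hv.linearIndependent
  have hb (i) : (b i : E) = v i := congrArg Subtype.val (Basis.span_apply hv.linearIndependent i)
  have hbo : Orthonormal 𝕜 b := by
    rw [← (Submodule.subtypeₗᵢ _).orthonormal_comp_iff]
    convert! hv using 1
    exact funext hb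
  have hsum := (b.toOrthonormalBasis hbo).sum_sq_norm_inner_right
    ((Submodule.span 𝕜 (Set.range v)).orthogonalProjectionOnto x)
  simpa only [b.coe_toOrthonormalBasis, Submodule.inner_orthogonalProjectionOnto_eq_of_mem_left,
    hb, Submodule.starProjection_apply, Submodule.coe_norm] using hsum.symm

theorem sum_norm_starProjection_span_range_sq {κ : Type*} [Fintype κ] (b : OrthonormalBasis κ 𝕜 E)
    {v : ι → E} (hv : Orthonormal 𝕜 v)
    [(Submodule.span 𝕜 (Set.range v)).HasOrthogonalProjection] :
    ∑ l, ‖(Submodule.span 𝕜 (Set.range v)).starProjection (b l)‖ ^ 2 = Fintype.card ι := by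
  simp_rw [norm_starProjection_span_range_sq hv]
  rw [Finset.sum_comm]
  simp [b.sum_sq_norm_inner_left, hv.norm_eq_one]

theorem norm_starProjection_sq_le_one (V : Submodule 𝕜 E) [V.HasOrthogonalProjection] {x : E}
    (hx : ‖x‖ ≤ 1) : ‖V.starProjection x‖ ^ 2 ≤ 1 :=
  pow_le_one₀ (norm_nonneg _) ((V.norm_starProjection_apply_le x).trans hx)

theorem exists_orthonormal_extension_mem [FiniteDimensional 𝕜 E] {V : Submodule 𝕜 E}
    (hV : finrank 𝕜 V = Fintype.card ι) {w : ι → E} (hw : Orthonormal 𝕜 w) {s : Set ι}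
    (hs : ∀ i ∈ s, w i ∈ V) :
    ∃ u : ι → E, Orthonormal 𝕜 u ∧ (∀ i, u i ∈ V) ∧ ∀ i ∈ s, u i = w i := by
  have hws : Orthonormal 𝕜 (s.domRestrict fun i => V.orthogonalProjectionOnto (w i)) := by
    rw [← V.subtypeₗᵢ.orthonormal_comp_iff]
    convert! hw.comp _ (Subtype.val_injective (p := (· ∈ s))) using 1
    funext i
    exact Submodule.starProjection_eq_self_iff.2 (hs i i.2)
  obtain ⟨b, hb⟩ := hws.exists_orthonormalBasis_extension_of_card_eq hV
  refine ⟨fun i => b i, b.orthonormal.comp_linearIsometry V.subtypeₗᵢ, fun i => (b i).2,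
    fun i hi => ?_⟩
  exact (congrArg Subtype.val (hb i hi)).trans (Submodule.starProjection_eq_self_iff.2 (hs i hi))

end Geometry

section SingularFrame

open Module LinearMap Finset
open scoped InnerProductSpace

variable {𝕜 E F : Type*} [RCLike 𝕜] [NormedAddCommGroup E] [InnerProductSpace 𝕜 E]
  [FiniteDimensional 𝕜 E] [NormedAddCommGroup F] [InnerProductSpace 𝕜 F] [FiniteDimensional 𝕜 F]

/-- An orthonormal system of right singular vectors of `T` belonging to its `k` largest singular
values, listed in decreasing order. -/
def IsRightSingularFrame {k : ℕ} (T : E →ₗ[𝕜] F) (v : Fin k → E) : Prop :=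
  Orthonormal 𝕜 v ∧ ∀ i, (adjoint T ∘ₗ T) (v i) = ((T.singularValues i ^ 2 : ℝ) : 𝕜) • v i

theorem exists_orthonormalBasis_isRightSingularFrame (T : E →ₗ[𝕜] F) :
    ∃ e : OrthonormalBasis (Fin (finrank 𝕜 E)) 𝕜 E, IsRightSingularFrame T e := by
  refine ⟨T.isSymmetric_adjoint_comp_self.eigenvectorBasis rfl, OrthonormalBasis.orthonormal _,
    fun i => ?_⟩
  rw [T.sq_singularValues_fin rfl]
  exact T.isSymmetric_adjoint_comp_self.apply_eigenvectorBasis rfl i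

theorem exists_isRightSingularFrame {k : ℕ} (hk : k ≤ finrank 𝕜 E) (T : E →ₗ[𝕜] F) :
    ∃ v : Fin k → E, IsRightSingularFrame T v := by
  obtain ⟨e, he⟩ := exists_orthonormalBasis_isRightSingularFrame T
  exact ⟨e ∘ Fin.castLE hk, he.1.comp _ (Fin.castLE_injective hk), fun i => he.2 (Fin.castLE hk i)⟩

namespace IsRightSingularFrame

variable {T : E →ₗ[𝕜] F} {k : ℕ} {v : Fin k → E}

theorem inner_adjoint_comp_self (hv : IsRightSingularFrame T v) (i : Fin k) (x : E) :
    ⟪v i, (adjoint T ∘ₗ T) x⟫_𝕜 = ((T.singularValues i ^ 2 : ℝ) : 𝕜) * ⟪v i, x⟫_𝕜 := by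
  rw [← T.isSymmetric_adjoint_comp_self, hv.2, inner_smul_left, RCLike.conj_ofReal]

theorem norm_apply (hv : IsRightSingularFrame T v) (i : Fin k) :
    ‖T (v i)‖ = T.singularValues i := by
  have h := hv.inner_adjoint_comp_self i (v i)
  rw [LinearMap.comp_apply, adjoint_inner_right, inner_self_eq_norm_sq_to_K,
    inner_self_eq_norm_sq_to_K, hv.1.norm_eq_one, RCLike.ofReal_one, one_pow, mul_one] at h
  exact (pow_left_inj₀ (norm_nonneg _) (T.singularValues_nonneg i) two_ne_zero).1
    (by exact_mod_cast h)

end IsRightSingularFrame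

variable {T : E →ₗ[𝕜] F} {e : OrthonormalBasis (Fin (finrank 𝕜 E)) 𝕜 E}

theorem norm_sq_apply_eq_sum (he : IsRightSingularFrame T e) (x : E) :
    ‖T x‖ ^ 2 = ∑ l, ‖⟪e l, x⟫_𝕜‖ ^ 2 * T.singularValues l ^ 2 := by
  have hterm (l) : ⟪x, e l⟫_𝕜 * ⟪e l, (adjoint T ∘ₗ T) x⟫_𝕜 =
      ((‖⟪e l, x⟫_𝕜‖ ^ 2 * T.singularValues l ^ 2 : ℝ) : 𝕜) := by
    rw [he.inner_adjoint_comp_self, mul_left_comm, ← inner_conj_symm, RCLike.conj_mul, mul_comm]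
    push_cast
    rfl
  have h : ⟪T x, T x⟫_𝕜 = ⟪x, (adjoint T ∘ₗ T) x⟫_𝕜 := by
    rw [LinearMap.comp_apply, adjoint_inner_right]
  rw [← e.sum_inner_mul_inner, inner_self_eq_norm_sq_to_K] at h
  simp only [hterm] at h
  exact_mod_cast h

theorem norm_apply_rpow_le_sum (he : IsRightSingularFrame T e) {p : ℝ} (hp : 2 ≤ p) {x : E}
    (hx : ‖x‖ = 1) : ‖T x‖ ^ p ≤ ∑ l, ‖⟪e l, x⟫_𝕜‖ ^ 2 * T.singularValues l ^ p := by
  have hpow {t : ℝ} (ht : 0 ≤ t) : (t ^ 2) ^ (p / 2) = t ^ p := by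
    rw [← Real.rpow_natCast_mul ht, Nat.cast_ofNat, mul_div_cancel₀ p two_ne_zero]
  have hjensen := (convexOn_rpow (show 1 ≤ p / 2 by linarith)).map_sum_le (t := univ)
    (w := fun l => ‖⟪e l, x⟫_𝕜‖ ^ 2) (p := fun l : Fin _ => T.singularValues l ^ 2)
    (fun _ _ => by positivity) (by rw [e.sum_sq_norm_inner_right, hx, one_pow])
    (fun l _ => sq_nonneg (T.singularValues l))
  simpa only [smul_eq_mul, ← norm_sq_apply_eq_sum he, hpow (norm_nonneg _),
    hpow (T.singularValues_nonneg _)] using hjensen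

theorem sum_norm_apply_rpow_le_sum_weight (he : IsRightSingularFrame T e) {p : ℝ} (hp : 2 ≤ p)
    {ι : Type*} [Fintype ι] {v : ι → E} (hv : Orthonormal 𝕜 v) :
    ∑ i, ‖T (v i)‖ ^ p ≤
      ∑ l, ‖(Submodule.span 𝕜 (Set.range v)).starProjection (e l)‖ ^ 2 * T.singularValues l ^ p :=
  calc ∑ i, ‖T (v i)‖ ^ p
      ≤ ∑ i, ∑ l, ‖⟪e l, v i⟫_𝕜‖ ^ 2 * T.singularValues l ^ p :=
        sum_le_sum fun i _ => norm_apply_rpow_le_sum he hp (hv.norm_eq_one i)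
    _ = ∑ l, (∑ i, ‖⟪v i, e l⟫_𝕜‖ ^ 2) * T.singularValues l ^ p := by
        rw [sum_comm]
        simp only [sum_mul, norm_inner_symm]
    _ = _ := by simp_rw [norm_starProjection_span_range_sq hv]

theorem antitone_singularValues_rpow (T : E →ₗ[𝕜] F) {p : ℝ} (hp : 0 ≤ p) :
    Antitone fun l => T.singularValues l ^ p := fun _ j hij =>
  Real.rpow_le_rpow (T.singularValues_nonneg j) (T.singularValues_antitone hij) hp

theorem sum_norm_apply_rpow_le (T : E →ₗ[𝕜] F) {p : ℝ} (hp : 2 ≤ p) {k : ℕ} {v : Fin k → E}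
    (hv : Orthonormal 𝕜 v) :
    ∑ i, ‖T (v i)‖ ^ p ≤ ∑ l ∈ range k, T.singularValues l ^ p := by
  obtain ⟨e, he⟩ := exists_orthonormalBasis_isRightSingularFrame T
  refine (sum_norm_apply_rpow_le_sum_weight he hp hv).trans ?_
  exact sum_weight_mul_le_sum_range (by simpa using hv.linearIndependent.fintype_card_le_finrank)
    (antitone_singularValues_rpow T (by linarith)) (fun _ => sq_nonneg _)
    (fun l => norm_starProjection_sq_le_one _ (e.norm_eq_one l).le)
    (by simp [sum_norm_starProjection_span_range_sq e hv])

theorem exists_isRightSingularFrame_mem (he : IsRightSingularFrame T e) {k : ℕ}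
    {V : Submodule 𝕜 E} (hV : finrank 𝕜 V = k)
    (hmem : ∀ l : Fin (finrank 𝕜 E), T.singularValues (k - 1) < T.singularValues l → e l ∈ V)
    (horth : ∀ l : Fin (finrank 𝕜 E), T.singularValues l < T.singularValues (k - 1) → e l ∈ Vᗮ) :
    ∃ u : Fin k → E, IsRightSingularFrame T u ∧ ∀ i, u i ∈ V := by
  have hkn : k ≤ finrank 𝕜 E := hV ▸ V.finrank_le
  obtain ⟨u, hu, huV, hue⟩ := exists_orthonormal_extension_mem (hV.trans (Fintype.card_fin k).symm)
    (he.1.comp _ (Fin.castLE_injective hkn))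
    (s := {i | T.singularValues (k - 1) < T.singularValues i}) fun i hi => hmem _ hi
  refine ⟨u, ⟨hu, fun i => ?_⟩, huV⟩
  by_cases hi : T.singularValues (k - 1) < T.singularValues i
  · rw [hue i hi]
    exact he.2 (Fin.castLE hkn i)
  have hσi : T.singularValues i = T.singularValues (k - 1) :=
    le_antisymm (not_lt.1 hi) (T.singularValues_antitone (by omega))
  refine InnerProductSpace.ext_inner_left_basis e.toBasis fun l => ?_
  rw [e.coe_toBasis, he.inner_adjoint_comp_self, inner_smul_right, hσi]
  rcases lt_trichotomy (T.singularValues l) (T.singularValues (k - 1)) with hl | hl | hl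
  · rw [Submodule.inner_left_of_mem_orthogonal (huV i) (horth l hl), mul_zero, mul_zero]
  · rw [hl]
  · have hlk : (l : ℕ) < k := by
      by_contra! h
      exact hl.not_ge (T.singularValues_antitone (by omega))
    have hul : u ⟨l, hlk⟩ = e l := hue ⟨l, hlk⟩ hl
    have hne : (⟨l, hlk⟩ : Fin k) ≠ i := by rintro rfl; exact hi hl
    rw [← hul, hu.2 hne, mul_zero, mul_zero]

theorem exists_isRightSingularFrame_of_sum_eq {p : ℝ} (hp : 2 ≤ p) {k : ℕ} {v : Fin k → E}
    (hv : Orthonormal 𝕜 v)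
    (heq : ∑ i, ‖T (v i)‖ ^ p = ∑ l ∈ range k, T.singularValues l ^ p) :
    ∃ u : Fin k → E, IsRightSingularFrame T u ∧ ∀ i, u i ∈ Submodule.span 𝕜 (Set.range v) := by
  obtain ⟨e, he⟩ := exists_orthonormalBasis_isRightSingularFrame T
  have hcard : finrank 𝕜 (Submodule.span 𝕜 (Set.range v)) = k := by
    rw [finrank_span_eq_card hv.linearIndependent, Fintype.card_fin]
  set V := Submodule.span 𝕜 (Set.range v)
  have hkn : k ≤ finrank 𝕜 E := hcard ▸ V.finrank_le
  have hd := antitone_singularValues_rpow T (show 0 ≤ p by linarith)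
  have ha0 (l) : 0 ≤ ‖V.starProjection (e l)‖ ^ 2 := sq_nonneg _
  have ha1 (l) := norm_starProjection_sq_le_one V (e.norm_eq_one l).le
  have hsum : ∑ l, ‖V.starProjection (e l)‖ ^ 2 = k := by
    rw [sum_norm_starProjection_span_range_sq e hv, Fintype.card_fin]
  have hweight := weight_eq_of_sum_weight_mul_eq_sum_range hkn hd ha0 ha1 hsum
    ((sum_weight_mul_le_sum_range hkn hd ha0 ha1 hsum).antisymm
      (heq.symm.trans_le (sum_norm_apply_rpow_le_sum_weight he hp hv)))
  have hne {l : ℕ} (hl : T.singularValues l ≠ T.singularValues (k - 1)) :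
      T.singularValues l ^ p ≠ T.singularValues (k - 1) ^ p :=
    (Real.rpow_left_injOn (by linarith)).ne (T.singularValues_nonneg _)
      (T.singularValues_nonneg _) hl
  refine exists_isRightSingularFrame_mem he hcard (fun l hl => ?_) fun l hl => ?_
  · have hlk : (l : ℕ) < k := by
      by_contra! h
      exact hl.not_ge (T.singularValues_antitone (by omega))
    have h1 := hweight l (hne hl.ne')
    rw [if_pos hlk, pow_eq_one_iff_of_nonneg (norm_nonneg _) two_ne_zero] at h1
    rw [V.mem_iff_norm_starProjection, h1, e.norm_eq_one]
  · have hlk : ¬ (l : ℕ) < k := fun h => hl.not_ge (T.singularValues_antitone (by omega))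
    have h0 := hweight l (hne hl.ne)
    rwa [if_neg hlk, sq_eq_zero_iff, norm_eq_zero, Submodule.starProjection_apply_eq_zero_iff] at h0

end SingularFrame

section FrameImage

variable {𝕜 E F ι : Type*} [NormedField 𝕜] [AddCommGroup E] [Module 𝕜 E]
  [NormedAddCommGroup F] [NormedSpace 𝕜 F]

/-- The images under `T` of a family of vectors, as a point of the `ℓ^p`-direct sum. For an
orthonormal family of `k` vectors, its norm is bounded by the Ky Fan `p`-`k` norm of `T`. -/
def frameImage (p : ℝ) (v : ι → E) (T : E →ₗ[𝕜] F) :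
    PiLp (ENNReal.ofReal p) fun _ : ι => F :=
  WithLp.toLp _ fun i => T (v i)

@[simp]
theorem frameImage_apply (p : ℝ) (v : ι → E) (T : E →ₗ[𝕜] F) (i : ι) :
    frameImage p v T i = T (v i) := rfl

theorem frameImage_add_smul (p : ℝ) (v : ι → E) (c : 𝕜) (T S : E →ₗ[𝕜] F) :
    frameImage p v (T + c • S) = frameImage p v T + c • frameImage p v S := rfl

theorem smul_frameImage_eq_smul_frameImage_of_mem_span {p : ℝ} {v : ι → E} {κ : Type*}
    {u : κ → E} {a b : 𝕜} {T S : E →ₗ[𝕜] F}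
    (h : a • frameImage p v S = b • frameImage p v T)
    (hu : ∀ j, u j ∈ Submodule.span 𝕜 (Set.range v)) :
    a • frameImage p u S = b • frameImage p u T := by
  have heq : Set.EqOn (a • S) (b • T) (Set.range v) := by
    rintro _ ⟨i, rfl⟩
    exact congrFun (congrArg WithLp.ofLp h) i
  exact PiLp.ext fun j => LinearMap.eqOn_span (f := a • S) (g := b • T) heq (hu j)

theorem norm_frameImage_add_smul_le {p : ℝ} (hp : 1 ≤ p) [Fintype ι] (v : ι → E)
    (T S : E →ₗ[𝕜] F) {c : 𝕜} (hc : ‖c‖ = 1) :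
    ‖frameImage p v (T + c • S)‖ ≤ ‖frameImage p v T‖ + ‖frameImage p v S‖ := by
  have : Fact (1 ≤ ENNReal.ofReal p) := ⟨by simpa using hp⟩
  rw [frameImage_add_smul]
  refine (norm_add_le _ _).trans_eq ?_
  rw [norm_smul, hc, one_mul]

end FrameImage

section KyFanNorm

open Module Finset

variable {𝕜 E F : Type*} [RCLike 𝕜] [NormedAddCommGroup E] [InnerProductSpace 𝕜 E]
  [FiniteDimensional 𝕜 E] [NormedAddCommGroup F] [InnerProductSpace 𝕜 F] [FiniteDimensional 𝕜 F]

/-- The Ky Fan `p`-`k` norm of a linear map between finite-dimensional inner product spaces. -/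
def opKyFanNorm (p : ℝ) (k : ℕ) (T : E →ₗ[𝕜] F) : ℝ :=
  (∑ i ∈ range k, T.singularValues i ^ p) ^ (1 / p)

theorem opKyFanNorm_nonneg (p : ℝ) (k : ℕ) (T : E →ₗ[𝕜] F) : 0 ≤ opKyFanNorm p k T :=
  Real.rpow_nonneg (sum_nonneg fun i _ => Real.rpow_nonneg (T.singularValues_nonneg i) p) _

theorem opKyFanNorm_rpow {p : ℝ} (hp : 0 < p) (k : ℕ) (T : E →ₗ[𝕜] F) :
    opKyFanNorm p k T ^ p = ∑ i ∈ range k, T.singularValues i ^ p := by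
  rw [opKyFanNorm, one_div, Real.rpow_inv_rpow _ hp.ne']
  exact sum_nonneg fun i _ => Real.rpow_nonneg (T.singularValues_nonneg i) p

variable {p : ℝ} {k : ℕ} {v : Fin k → E}

theorem norm_frameImage_le (hp : 2 ≤ p) (hv : Orthonormal 𝕜 v) (T : E →ₗ[𝕜] F) :
    ‖frameImage p v T‖ ≤ opKyFanNorm p k T := by
  have hp0 : 0 < p := by linarith
  have : Fact (1 ≤ ENNReal.ofReal p) := ⟨by simp; linarith⟩
  rw [← Real.rpow_le_rpow_iff (norm_nonneg _) (opKyFanNorm_nonneg p k T) hp0,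
    opKyFanNorm_rpow hp0, piLp_norm_rpow_eq_sum hp0]
  exact sum_norm_apply_rpow_le T hp hv

theorem IsRightSingularFrame.norm_frameImage {T : E →ₗ[𝕜] F} (hp : 1 ≤ p)
    (hv : IsRightSingularFrame T v) : ‖frameImage p v T‖ = opKyFanNorm p k T := by
  have hp0 : 0 < p := by linarith
  have : Fact (1 ≤ ENNReal.ofReal p) := ⟨by simpa using hp⟩
  refine (Real.rpow_left_inj (norm_nonneg _) (opKyFanNorm_nonneg p k T) hp0.ne').1 ?_
  rw [opKyFanNorm_rpow hp0, piLp_norm_rpow_eq_sum hp0]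
  simp only [frameImage_apply, hv.norm_apply]
  exact Fin.sum_univ_eq_sum_range (fun i => T.singularValues i ^ p) k

theorem exists_isRightSingularFrame_of_norm_frameImage_eq {T : E →ₗ[𝕜] F} (hp : 2 ≤ p)
    (hv : Orthonormal 𝕜 v) (h : ‖frameImage p v T‖ = opKyFanNorm p k T) :
    ∃ u : Fin k → E, IsRightSingularFrame T u ∧ ∀ i, u i ∈ Submodule.span 𝕜 (Set.range v) := by
  have hp0 : 0 < p := by linarith
  refine exists_isRightSingularFrame_of_sum_eq hp hv ?_
  rw [← opKyFanNorm_rpow hp0, ← h, piLp_norm_rpow_eq_sum hp0]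
  rfl

theorem opKyFanNorm_add_smul_le (hp : 2 ≤ p) (hk : k ≤ finrank 𝕜 E) (T S : E →ₗ[𝕜] F) {c : 𝕜}
    (hc : ‖c‖ = 1) : opKyFanNorm p k (T + c • S) ≤ opKyFanNorm p k T + opKyFanNorm p k S := by
  obtain ⟨v, hv⟩ := exists_isRightSingularFrame hk (T + c • S)
  calc opKyFanNorm p k (T + c • S) = ‖frameImage p v (T + c • S)‖ :=
        (hv.norm_frameImage (by linarith)).symm
    _ ≤ ‖frameImage p v T‖ + ‖frameImage p v S‖ :=
        norm_frameImage_add_smul_le (by linarith) v T S hc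
    _ ≤ opKyFanNorm p k T + opKyFanNorm p k S :=
        add_le_add (norm_frameImage_le hp hv.1 T) (norm_frameImage_le hp hv.1 S)

theorem opKyFanNorm_add_eq_of_opKyFanNorm_eq_zero (hp : 2 ≤ p) (hk : k ≤ finrank 𝕜 E)
    {T : E →ₗ[𝕜] F} (hT : opKyFanNorm p k T = 0) (S : E →ₗ[𝕜] F) :
    opKyFanNorm p k (T + S) = opKyFanNorm p k S := by
  have hle := opKyFanNorm_add_smul_le hp hk T S (norm_one (α := 𝕜))
  have hge := opKyFanNorm_add_smul_le hp hk (T + S) T (c := -1) (by simp)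
  rw [one_smul, hT, zero_add] at hle
  rw [neg_one_smul, add_neg_cancel_comm, hT, add_zero] at hge
  exact hle.antisymm hge

end KyFanNorm

section Parallel

open Module ComplexConjugate

variable {𝕜 E F : Type*} [RCLike 𝕜] [NormedAddCommGroup E] [InnerProductSpace 𝕜 E]
  [FiniteDimensional 𝕜 E] [NormedAddCommGroup F] [InnerProductSpace 𝕜 F] [FiniteDimensional 𝕜 F]
  {p : ℝ} {k : ℕ} {T S : E →ₗ[𝕜] F}

theorem norm_semiInner_frameImage_le (hp : 2 ≤ p) {v : Fin k → E} (hv : Orthonormal 𝕜 v)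
    (T S : E →ₗ[𝕜] F) :
    ‖(semiInner p (frameImage p v T) (frameImage p v S) : 𝕜)‖ ≤
      opKyFanNorm p k T ^ (p - 1) * opKyFanNorm p k S := by
  have : Fact (1 ≤ ENNReal.ofReal p) := ⟨by simp; linarith⟩
  refine (norm_semiInner_le (by linarith) _ _).trans ?_
  have hT : ‖frameImage p v T‖ ^ (p - 1) ≤ opKyFanNorm p k T ^ (p - 1) :=
    Real.rpow_le_rpow (norm_nonneg _) (norm_frameImage_le hp hv T) (by linarith)
  exact mul_le_mul hT (norm_frameImage_le hp hv S) (norm_nonneg _)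
    (Real.rpow_nonneg (opKyFanNorm_nonneg p k T) _)

theorem opKyFanNorm_add_conj_smul_eq_add (hp : 2 ≤ p) (hT : 0 < opKyFanNorm p k T)
    {v : Fin k → E} (hv : IsRightSingularFrame T v) {c : 𝕜} (hc : ‖c‖ = 1)
    (h : semiInner p (frameImage p v T) (frameImage p v S) =
      c * ((opKyFanNorm p k T ^ (p - 1) * opKyFanNorm p k S : ℝ) : 𝕜)) :
    opKyFanNorm p k (T + conj c • S) = opKyFanNorm p k T + opKyFanNorm p k S := by
  have hk : k ≤ finrank 𝕜 E := by simpa using hv.1.linearIndependent.fintype_card_le_finrank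
  refine (opKyFanNorm_add_smul_le hp hk T S (by rwa [RCLike.norm_conj])).antisymm ?_
  have hpair : semiInner p (frameImage p v T) (frameImage p v (T + conj c • S)) =
      ((opKyFanNorm p k T ^ (p - 1) * (opKyFanNorm p k T + opKyFanNorm p k S) : ℝ) : 𝕜) := by
    rw [frameImage_add_smul, semiInner_add_right, semiInner_smul_right, h,
      semiInner_self (by linarith), hv.norm_frameImage (by linarith), ← mul_assoc,
      RCLike.conj_mul, hc, mul_add, ← Real.rpow_add_one hT.ne', sub_add_cancel]
    push_cast
    ring
  have hle := norm_semiInner_frameImage_le hp hv.1 T (T + conj c • S)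
  rw [hpair, RCLike.norm_of_nonneg (mul_nonneg (Real.rpow_nonneg hT.le _)
    (add_nonneg hT.le (opKyFanNorm_nonneg p k S)))] at hle
  exact le_of_mul_le_mul_left hle (Real.rpow_pos_of_pos hT _)

theorem exists_norm_frameImage_eq_of_opKyFanNorm_add_smul_eq (hp : 2 ≤ p) (hk : k ≤ finrank 𝕜 E)
    {c : 𝕜} (hc : ‖c‖ = 1)
    (h : opKyFanNorm p k (T + c • S) = opKyFanNorm p k T + opKyFanNorm p k S) :
    ∃ v : Fin k → E, Orthonormal 𝕜 v ∧ ‖frameImage p v T‖ = opKyFanNorm p k T ∧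
      ‖frameImage p v S‖ = opKyFanNorm p k S ∧
      ‖frameImage p v T + c • frameImage p v S‖ = opKyFanNorm p k T + opKyFanNorm p k S := by
  obtain ⟨v, hv⟩ := exists_isRightSingularFrame hk (T + c • S)
  have hTS := (hv.norm_frameImage (p := p) (by linarith)).trans h
  have hadd := norm_frameImage_add_smul_le (p := p) (by linarith) v T S hc
  have hT := norm_frameImage_le hp hv.1 T
  have hS := norm_frameImage_le hp hv.1 S
  exact ⟨v, hv.1, by linarith, by linarith, hTS⟩

theorem exists_semiInner_eq_of_opKyFanNorm_add_smul_eq (hp : 2 ≤ p) (hk : k ≤ finrank 𝕜 E)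
    (hT : 0 < opKyFanNorm p k T) {c : 𝕜} (hc : ‖c‖ = 1)
    (h : opKyFanNorm p k (T + c • S) = opKyFanNorm p k T + opKyFanNorm p k S) :
    ∃ u : Fin k → E, IsRightSingularFrame T u ∧
      semiInner p (frameImage p u T) (frameImage p u S) =
        conj c * ((opKyFanNorm p k T ^ (p - 1) * opKyFanNorm p k S : ℝ) : 𝕜) := by
  have hp1 : 1 ≤ p := by linarith
  have : Fact (1 ≤ ENNReal.ofReal p) := ⟨by simpa using hp1⟩
  obtain ⟨v, hv, hvT, hvS, hadd⟩ := exists_norm_frameImage_eq_of_opKyFanNorm_add_smul_eq hp hk hc h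
  have hcS : ‖c • frameImage p v S‖ = opKyFanNorm p k S := by rw [norm_smul, hc, one_mul, hvS]
  have hprop := norm_smul_eq_norm_smul_of_piLp_norm_add_eq (𝕜 := 𝕜) (by linarith)
    (hadd.trans (by rw [hvT, hcS]))
  rw [hvT, hcS, smul_smul] at hprop
  obtain ⟨u, hu, huv⟩ := exists_isRightSingularFrame_of_norm_frameImage_eq hp hv hvT
  refine ⟨u, hu, ?_⟩
  have hpair := congrArg (semiInner (𝕜 := 𝕜) p (frameImage p u T))
    (smul_frameImage_eq_smul_frameImage_of_mem_span hprop huv)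
  have hTp : opKyFanNorm p k T ^ p = opKyFanNorm p k T * opKyFanNorm p k T ^ (p - 1) := by
    rw [mul_comm, ← Real.rpow_add_one hT.ne', sub_add_cancel]
  rw [semiInner_smul_right, semiInner_smul_right, semiInner_self (by linarith),
    hu.norm_frameImage hp1, hTp] at hpair
  have hcc : conj c * c = 1 := by rw [RCLike.conj_mul, hc]; simp
  have hT' : (opKyFanNorm p k T : 𝕜) ≠ 0 := RCLike.ofReal_ne_zero.2 hT.ne'
  refine mul_left_cancel₀ (mul_ne_zero hT' (left_ne_zero_of_mul_eq_one (mul_comm _ c ▸ hcc))) ?_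
  rw [hpair]
  push_cast
  linear_combination
    -(opKyFanNorm p k S * opKyFanNorm p k T * ((opKyFanNorm p k T ^ (p - 1) : ℝ) : 𝕜)) * hcc

theorem exists_opKyFanNorm_add_smul_eq_iff (hp : 2 ≤ p) (hk : k ≤ finrank 𝕜 E)
    (T S : E →ₗ[𝕜] F) :
    (∃ c : 𝕜, ‖c‖ = 1 ∧ opKyFanNorm p k (T + c • S) = opKyFanNorm p k T + opKyFanNorm p k S) ↔
      ∃ v : Fin k → E, IsRightSingularFrame T v ∧ ∃ c : 𝕜, ‖c‖ = 1 ∧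
        semiInner p (frameImage p v T) (frameImage p v S) =
          c * ((opKyFanNorm p k T ^ (p - 1) * opKyFanNorm p k S : ℝ) : 𝕜) := by
  rcases (opKyFanNorm_nonneg p k T).eq_or_lt' with hT | hT
  · obtain ⟨v, hv⟩ := exists_isRightSingularFrame hk T
    have hzero : opKyFanNorm p k T ^ (p - 1) * opKyFanNorm p k S = 0 := by
      rw [hT, Real.zero_rpow (by linarith), zero_mul]
    have hpair := norm_semiInner_frameImage_le hp hv.1 T S
    rw [hzero, norm_le_zero_iff] at hpair
    refine iff_of_true ⟨1, norm_one, ?_⟩ ⟨v, hv, 1, norm_one, ?_⟩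
    · rw [one_smul, opKyFanNorm_add_eq_of_opKyFanNorm_eq_zero hp hk hT, hT, zero_add]
    · rw [hpair, hzero, RCLike.ofReal_zero, mul_zero]
  · constructor
    · rintro ⟨c, hc, h⟩
      obtain ⟨u, hu, hpair⟩ := exists_semiInner_eq_of_opKyFanNorm_add_smul_eq hp hk hT hc h
      exact ⟨u, hu, conj c, by rwa [RCLike.norm_conj], hpair⟩
    · rintro ⟨v, hv, c, hc, h⟩
      exact ⟨conj c, by rwa [RCLike.norm_conj], opKyFanNorm_add_conj_smul_eq_add hp hT hv hc h⟩

end Parallel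

section GramPower

open LinearMap Finset
open scoped InnerProductSpace

variable {𝕜 E F : Type*} [RCLike 𝕜] [NormedAddCommGroup E] [InnerProductSpace 𝕜 E]
  [FiniteDimensional 𝕜 E] [NormedAddCommGroup F] [InnerProductSpace 𝕜 F] [FiniteDimensional 𝕜 F]

/-- The function `f` of a symmetric operator `H`: it acts as `f r` on the `r`-eigenspace of `H`. -/
def spectralCalculus {H : E →ₗ[𝕜] E} (hH : H.IsSymmetric) (f : ℝ → ℝ) : E →ₗ[𝕜] E :=
  ∑ i, (f (hH.eigenvalues rfl i) : 𝕜) •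
    InnerProductSpace.rankOne 𝕜 (hH.eigenvectorBasis rfl i) (hH.eigenvectorBasis rfl i)

variable {H : E →ₗ[𝕜] E} (hH : H.IsSymmetric) (f : ℝ → ℝ)

theorem isSymmetric_spectralCalculus : (spectralCalculus hH f).IsSymmetric :=
  isSymmetric_sum _ fun _ _ =>
    (InnerProductSpace.isSymmetric_rankOne_self _).smul (RCLike.conj_ofReal _)

theorem spectralCalculus_apply_of_eigenvector {r : ℝ} {x : E} (hx : H x = (r : 𝕜) • x) :
    spectralCalculus hH f x = (f r : 𝕜) • x := by
  have hterm (i) : (f (hH.eigenvalues rfl i) : 𝕜) * ⟪hH.eigenvectorBasis rfl i, x⟫_𝕜 =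
      f r * ⟪hH.eigenvectorBasis rfl i, x⟫_𝕜 := by
    have h : ((hH.eigenvalues rfl i : 𝕜) - r) * ⟪hH.eigenvectorBasis rfl i, x⟫_𝕜 = 0 := by
      rw [sub_mul, sub_eq_zero, ← inner_smul_right _ x (r : 𝕜), ← hx, ← hH,
        hH.apply_eigenvectorBasis rfl, inner_smul_left, RCLike.conj_ofReal]
    rcases mul_eq_zero.1 h with hr | h0
    · rw [RCLike.ofReal_injective (sub_eq_zero.1 hr)]
    · rw [h0, mul_zero, mul_zero]
  calc spectralCalculus hH f x
      = ∑ i, ((f (hH.eigenvalues rfl i) : 𝕜) * ⟪hH.eigenvectorBasis rfl i, x⟫_𝕜) •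
          hH.eigenvectorBasis rfl i := by
        simp [spectralCalculus, LinearMap.sum_apply, smul_smul]
    _ = (f r : 𝕜) • x := by
        simp only [hterm, mul_smul, ← smul_sum, OrthonormalBasis.sum_repr']

/-- The power `(T⋆ T) ^ s` of the Gram operator of `T`, which is the identity for `s = 0`. -/
def gramRPow (T : E →ₗ[𝕜] F) (s : ℝ) : E →ₗ[𝕜] E :=
  spectralCalculus T.isSymmetric_adjoint_comp_self fun t => t ^ s

theorem IsRightSingularFrame.sum_inner_gramRPow {T : E →ₗ[𝕜] F} {k : ℕ} {v : Fin k → E}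
    (hv : IsRightSingularFrame T v) (p : ℝ) (S : E →ₗ[𝕜] F) :
    ∑ i, ⟪v i, (gramRPow T ((p - 2) / 2) ∘ₗ adjoint T ∘ₗ S) (v i)⟫_𝕜 =
      semiInner p (frameImage p v T) (frameImage p v S) := by
  refine sum_congr rfl fun i _ => ?_
  have hpow : (T.singularValues i ^ 2) ^ ((p - 2) / 2) = T.singularValues i ^ (p - 2) := by
    rw [← Real.rpow_natCast_mul (T.singularValues_nonneg i), Nat.cast_ofNat,
      mul_div_cancel₀ _ two_ne_zero]
  rw [LinearMap.comp_apply, LinearMap.comp_apply, gramRPow, ← isSymmetric_spectralCalculus,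
    spectralCalculus_apply_of_eigenvector _ _ (hv.2 i), inner_smul_left, RCLike.conj_ofReal,
    adjoint_inner_right, hpow, frameImage_apply, frameImage_apply, hv.norm_apply]

end GramPower

section Matrix

open Matrix

variable {𝕜 m n : Type*} [RCLike 𝕜] [Fintype m] [Fintype n] [DecidableEq n]

theorem cfc_mulVec_eigenvectorBasis {A : Matrix n n 𝕜} (hA : A.IsHermitian) (f : ℝ → ℝ) (j : n) :
    hA.cfc f *ᵥ hA.eigenvectorBasis j = (f (hA.eigenvalues j) : 𝕜) • hA.eigenvectorBasis j := by
  rw [IsHermitian.cfc, Unitary.conjStarAlgAut_apply, ← mulVec_mulVec, ← mulVec_mulVec,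
    hA.star_eigenvectorUnitary_mulVec, diagonal_mulVec_single, Function.comp_apply,
    Function.comp_apply, mul_one, ← hA.eigenvectorUnitary_mulVec, ← mulVec_smul,
    ← Pi.single_smul, smul_eq_mul, mul_one]

theorem toEuclideanLin_cfc {A : Matrix n n 𝕜} (hA : A.IsHermitian) (f : ℝ → ℝ)
    (hsymm : (toEuclideanLin A).IsSymmetric) :
    toEuclideanLin (hA.cfc f) = spectralCalculus hsymm f := by
  refine hA.eigenvectorBasis.toBasis.ext fun j => ?_
  rw [OrthonormalBasis.coe_toBasis,
    spectralCalculus_apply_of_eigenvector hsymm f (r := hA.eigenvalues j)]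
  · exact congrArg (WithLp.toLp 2) (cfc_mulVec_eigenvectorBasis hA f j)
  · refine congrArg (WithLp.toLp 2) ((hA.mulVec_eigenvectorBasis j).trans ?_)
    exact RCLike.real_smul_eq_coe_smul (K := 𝕜) _ _

theorem toEuclideanLin_conjTranspose_mul (A : Matrix m n 𝕜) {l : Type*} [Fintype l]
    [DecidableEq l] (B : Matrix m l 𝕜) :
    toEuclideanLin (Aᴴ * B) = LinearMap.adjoint (toEuclideanLin A) ∘ₗ toEuclideanLin B := by
  classical
  rw [← toEuclideanLin_conjTranspose_eq_adjoint]
  exact toLpLin_mul_same _ _ _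

theorem toEuclideanLin_gramPow {m n : ℕ} (A : Matrix (Fin m) (Fin n) ℂ) (s : ℝ) :
    toEuclideanLin (gramPow A s) = gramRPow (toEuclideanLin A) s := by
  have hA := toEuclideanLin_conjTranspose_mul A A
  have := (toEuclideanLin A).isSymmetric_adjoint_comp_self
  rw [gramPow, toEuclideanLin_cfc _ _ (hA ▸ this), gramRPow]
  congr 1

theorem toEuclideanLin_gramPow_mul_conjTranspose_mul {m n : ℕ} (A B : Matrix (Fin m) (Fin n) ℂ)
    (s : ℝ) : toEuclideanLin (gramPow A s * Aᴴ * B) =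
      gramRPow (toEuclideanLin A) s ∘ₗ LinearMap.adjoint (toEuclideanLin A) ∘ₗ
        toEuclideanLin B := by
  rw [Matrix.mul_assoc, ← toEuclideanLin_gramPow, ← toEuclideanLin_conjTranspose_mul]
  exact toLpLin_mul_same _ _ _

theorem normParallel_iff_toEuclideanLin {m n k : ℕ} {p : ℝ} {A B : Matrix (Fin m) (Fin n) ℂ} :
    NormParallel p k A B ↔ ∃ c : ℂ, ‖c‖ = 1 ∧
      opKyFanNorm p k (toEuclideanLin A + c • toEuclideanLin B) =
        opKyFanNorm p k (toEuclideanLin A) + opKyFanNorm p k (toEuclideanLin B) := by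
  simp only [← map_smul, ← map_add]
  rfl

end Matrix

end KyFanPK

end

theorem mainTheorem11_general {𝕜 E F : Type*} [RCLike 𝕜] [NormedAddCommGroup E]
    [InnerProductSpace 𝕜 E] [FiniteDimensional 𝕜 E] [NormedAddCommGroup F]
    [InnerProductSpace 𝕜 F] [FiniteDimensional 𝕜 F] {k : ℕ} (hk : k ≤ Module.finrank 𝕜 E)
    {p : ℝ} (hp : 2 ≤ p) (T S : E →ₗ[𝕜] F) :
    (∃ c : 𝕜, ‖c‖ = 1 ∧ KyFanPK.opKyFanNorm p k (T + c • S) =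
        KyFanPK.opKyFanNorm p k T + KyFanPK.opKyFanNorm p k S) ↔
      ∃ v : Fin k → E,
        Orthonormal 𝕜 v ∧
        (∀ i : Fin k, (T.adjoint ∘ₗ T) (v i) = ((T.singularValues i ^ 2 : ℝ) : 𝕜) • v i) ∧
        ∃ c : 𝕜, ‖c‖ = 1 ∧
          ∑ i, inner 𝕜 (v i) ((KyFanPK.gramRPow T ((p - 2) / 2) ∘ₗ T.adjoint ∘ₗ S) (v i)) =
            c * ((KyFanPK.opKyFanNorm p k T ^ (p - 1) * KyFanPK.opKyFanNorm p k S : ℝ) : 𝕜) := by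
  rw [KyFanPK.exists_opKyFanNorm_add_smul_eq_iff hp hk]
  refine exists_congr fun v => (and_congr_right fun hv => ?_).trans and_assoc
  rw [hv.sum_inner_gramRPow]

theorem mainTheorem11 {m n k : ℕ} (hk : 1 ≤ k) (hkn : k ≤ n) (p : ℝ) (hp : 2 ≤ p)
    (A B : Matrix (Fin m) (Fin n) ℂ) :
    KyFanPK.NormParallel p k A B ↔
      ∃ v : Fin k → EuclideanSpace ℂ (Fin n),
        Orthonormal ℂ v ∧
        (∀ i : Fin k, Matrix.toEuclideanLin (Aᴴ * A) (v i) =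
          ((KyFanPK.sval A i ^ 2 : ℝ) : ℂ) • v i) ∧
        ∃ c : ℂ, ‖c‖ = 1 ∧
          ∑ i : Fin k, inner ℂ (v i)
              (Matrix.toEuclideanLin (KyFanPK.gramPow A ((p - 2) / 2) * Aᴴ * B) (v i)) =
            c * ((KyFanPK.kyFanNorm p k A ^ (p - 1) * KyFanPK.kyFanNorm p k B : ℝ) : ℂ) := by
  rw [KyFanPK.normParallel_iff_toEuclideanLin, KyFanPK.toEuclideanLin_conjTranspose_mul,
    KyFanPK.toEuclideanLin_gramPow_mul_conjTranspose_mul]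
  exact mainTheorem11_general (hkn.trans_eq finrank_euclideanSpace_fin.symm) hp
    (Matrix.toEuclideanLin A) (Matrix.toEuclideanLin B)
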